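/- Consider $N\ge 1$ queues sharing one server in slotted time $t=0,1,2,\dots$. Let $A_j(t)$, $1\le j\le N$, $t\ge 0$, be mutually independent Bernoulli random variables with $P\{A_j(t)=1\}=\lambda_j$. The queue lengths are $Q_j(0)=A_j(0)$ and $Q_j(t+1)=(Q_j(t)-D_j(t))^+ + A_j(t+1)$, where $D_j(t)=1$ if slot $t$ is given to queue $j$ and $D_j(t)=0$ otherwise. Under \emph{cyclic exhaustive service}, slot $t$ is given to the incumbent $u(t)$ (the queue to which slot $t-1$ was given; $u(0)$ is an arbitrary fixed queue) if $Q_{u(t)}(t)>0$, and otherwise to the next queue $u(t)+1$ in cyclic order (queue $1$ follows queue $N$); if that queue is empty, the slot is wasted. \textbf{Theorem.} Let $\boldsymbol\lambda=(\lambda_1,\dots,\lambda_N)$ satisfy $\lambda_j\ge 0$ for all $j$ and $\sum_{j=1}^N\lambda_j<1$ (the rates may be unequal). Then the system is stable under cyclic exhaustive service, that is: \begin{enumerate} \item the process $(\mathbf Q(t),u(t))_{t\ge0}$ is a time-homogeneous Markov chain which, on the set of states that it visits with positive probability, is irreducible and positive recurrent; \item almost surely there are infinitely many polling instants, i.e.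 slots $t$ with $Q_{u(t)}(t)=0$, at which the server moves to the next queue; and if $\mathbf Q^{(n)}$ denotes the vector of queue lengths at the $n$-th polling instant ($n=0,1,2,\dots$) and $I^{(n)}$ the queue at which the server then arrives, then for each $k\in\{0,\dots,N-1\}$ the process $(\mathbf Q^{(nN+k)},I^{(nN+k)})_{n\ge0}$ is a time-homogeneous Markov chain which, on the set of states that it visits with positive probability, is irreducible, aperiodic and positive recurrent (hence ergodic). \end{enumerate} Since the policy does not depend on $\boldsymbol\lambda$, cyclic exhaustive service is throughput optimal. -/

import Mathlib

open MeasureTheory ProbabilityTheory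
open scoped ENNReal

namespace Polling

section Chain

variable {Ω S : Type*} [MeasurableSpace Ω]

/-- `X` is a time-homogeneous Markov chain on the discrete space `S` under `P`: there is a
stochastic matrix `p` giving the one-step transition probabilities, conditionally on every past. -/
def IsMarkovChain (P : Measure Ω) (X : ℕ → Ω → S) : Prop :=
  ∃ p : S → S → ℝ≥0∞, (∀ x, ∑' y, p x y = 1) ∧
    ∀ (n : ℕ) (s : ℕ → S),
      P {ω | ∀ i ≤ n + 1, X i ω = s i} = P {ω | ∀ i ≤ n, X i ω = s i} * p (s n) (s (n + 1))

/-- `x` is a state of the chain: it is visited with positive probability at some time. -/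
def IsStateOf (P : Measure Ω) (X : ℕ → Ω → S) (x : S) : Prop :=
  ∃ n, P {ω | X n ω = x} ≠ 0

/-- The time until the next visit to `x` strictly after time `n` (`∞` if there is none). -/
noncomputable def returnTime (X : ℕ → Ω → S) (x : S) (n : ℕ) (ω : Ω) : ℝ≥0∞ :=
  ⨅ (k : ℕ) (_ : 0 < k ∧ X (n + k) ω = x), (k : ℝ≥0∞)

/-- Any two states of the chain lead to each other with positive probability. -/
def IsIrreducible (P : Measure Ω) (X : ℕ → Ω → S) : Prop :=
  ∀ (x y : S) (m : ℕ), P {ω | X m ω = x} ≠ 0 → IsStateOf P X y →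
    ∃ k, P {ω | X m ω = x ∧ X (m + k) ω = y} ≠ 0

/-- Whenever the chain is at `x`, the mean time until it next visits `x` is finite. -/
def IsPositiveRecurrentState (P : Measure Ω) (X : ℕ → Ω → S) (x : S) : Prop :=
  ∀ n, ∫⁻ ω in {ω | X n ω = x}, returnTime X x n ω ∂P < ∞

/-- `X` is an irreducible, positive recurrent, time-homogeneous Markov chain
(on the set of states it can visit). -/
structure IsPositiveRecurrentChain (P : Measure Ω) (X : ℕ → Ω → S) : Prop where
  markov : IsMarkovChain P X
  irreducible : IsIrreducible P X
  positiveRecurrent : ∀ x, IsStateOf P X x → IsPositiveRecurrentState P X x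

/-- Every state has period one: the possible return times have no common divisor but `1`. -/
def IsAperiodic (P : Measure Ω) (X : ℕ → Ω → S) : Prop :=
  ∀ (x : S) (m : ℕ), P {ω | X m ω = x} ≠ 0 →
    ∀ d : ℕ, (∀ k, 0 < k → P {ω | X m ω = x ∧ X (m + k) ω = x} ≠ 0 → d ∣ k) → d = 1

/-- `X` is an ergodic Markov chain: irreducible, positive recurrent and aperiodic. -/
structure IsErgodicChain (P : Measure Ω) (X : ℕ → Ω → S) : Prop
    extends IsPositiveRecurrentChain P X where
  aperiodic : IsAperiodic P X

end Chain

/-- The arrival rate vectors with nonnegative entries of sum less than one. -/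
def capacityRegion (N : ℕ) : Set (Fin N → ℝ) :=
  {lam | (∀ j, 0 ≤ lam j) ∧ ∑ j, lam j < 1}

/-- The state at the beginning of a slot: the queue lengths, and the incumbent, that is, the queue
to which the previous slot was given. -/
abbrev State (N : ℕ) : Type := (Fin N → ℕ) × Fin N

section Model

variable {N : ℕ} [NeZero N]

/-- Cyclic exhaustive service: the slot goes to the incumbent if it is nonempty, and otherwise to
the next queue in cyclic order (addition in `Fin N` is modulo `N`). -/
def cyclicExhaustive (x : State N) : Fin N :=
  if 0 < x.1 x.2 then x.2 else x.2 + 1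

/-- One slot: the queue holding the slot loses one packet if it has one (subtraction in `ℕ` is the
positive part), and then the arrivals `a` of the next slot boundary join the queues. -/
def step (x : State N) (a : Fin N → ℕ) : State N :=
  (fun j => (x.1 j - if j = cyclicExhaustive x then 1 else 0) + a j, cyclicExhaustive x)

variable {Ω : Type*}

/-- The state process, started from the queue lengths `A 0` and the incumbent `u₀`. -/
def process (A : ℕ → Fin N → Ω → ℕ) (u₀ : Fin N) : ℕ → Ω → State N
  | 0, ω => (fun j => A 0 j ω, u₀)
  | t + 1, ω => step (process A u₀ t ω) (fun j => A (t + 1) j ω)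

/-- Slot `t` is a polling instant: the incumbent is empty, so the server moves on. -/
def IsPollingInstant (A : ℕ → Fin N → Ω → ℕ) (u₀ : Fin N) (ω : Ω) (t : ℕ) : Prop :=
  (process A u₀ t ω).1 (process A u₀ t ω).2 = 0

/-- The system at the `n`-th polling instant (counted from `0`): the queue lengths, and the queue
at which the server then arrives. -/
noncomputable def polledProcess (A : ℕ → Fin N → Ω → ℕ) (u₀ : Fin N) (n : ℕ) (ω : Ω) : State N :=
  let x := process A u₀ (Nat.nth (IsPollingInstant A u₀ ω) n) ω
  (x.1, cyclicExhaustive x)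

end Model

end Polling

/-!
The state process is a recursion driven by i.i.d. arrival vectors: the arrivals after time `t`
are independent of the past up to `t`, with a law that does not depend on `t`
(`IsArrivalSystem.measure_inter_future`). This gives the Markov property of the state process
and, on decomposing over the slot at which the `n`-th polling instant falls, that of the polled
process (`isMarkovChain_polled`).

Positive recurrence comes from Foster's criterion (`lintegral_returnTime_le`) with a Lyapunov
function adapted to a single state `z` (`exists_lyapunov`). Suppose that some queue holds at least
`T` packets. It stays nonempty during the next `T` slots, and a slot is wasted only if the server
moves to the next queue, which happens at most `N` times before it reaches that large queue. So the
mean total queue length decreases over these `T` slots by at least `T (1 - ∑ λ_j) - N`, which is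
at least `1` for large `T`; summing the mean total over `T` successive times turns this into a
drift in one step. On the finitely many remaining states the drift is repaired by adding a large
multiple of `∑_{k < L} P_x(z is not visited at the times 0, …, k)`, which decreases in mean because
`z` is reached from everywhere with positive probability: without arrivals the system empties, and
from the empty system every state of the chain is reached (`exists_isLikely_of_isStateOf`).

At a polling instant the polled process is at `x` exactly when the state process is at `before x`,
and the position of the server determines the number of polling instants modulo `N`. Hence a return of the state
process is a return of the `N`-step polled process, after no more cycles than slots
(`returnTime_polledProcess_le`), so that positive recurrence carries over. A loop through the
empty system may be prolonged by one empty cycle, which gives aperiodicity.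
-/

namespace Polling

/-! ### The arrival process -/

/-- The hypotheses on the arrivals: independent Bernoulli variables whose rates lie in the
capacity region. -/
structure IsArrivalSystem {N : ℕ} {Ω : Type*} [MeasurableSpace Ω] (lam : Fin N → ℝ)
    (P : Measure Ω) (A : ℕ → Fin N → Ω → ℕ) : Prop where
  rates : lam ∈ capacityRegion N
  measurable : ∀ t j, Measurable (A t j)
  indep : iIndepFun (fun (i : ℕ × Fin N) => A i.1 i.2) P
  one : ∀ t j, P {ω | A t j ω = 1} = ENNReal.ofReal (lam j)
  zero : ∀ t j, P {ω | A t j ω = 0} = ENNReal.ofReal (1 - lam j)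

section Arrivals

variable {N : ℕ} {Ω : Type*}

/-- The arrivals after slot boundary `t`, reindexed from `0`. -/
def future (A : ℕ → Fin N → Ω → ℕ) (t : ℕ) (ω : Ω) : ℕ → Fin N → ℕ :=
  fun i j => A (t + 1 + i) j ω

/-- The `σ`-algebra generated by the arrivals up to and including slot boundary `t`. -/
@[reducible] def past (A : ℕ → Fin N → Ω → ℕ) (t : ℕ) : MeasurableSpace Ω :=
  ⨆ i ∈ {i : ℕ × Fin N | i.1 ≤ t}, MeasurableSpace.comap (A i.1 i.2) inferInstance

lemma past_mono (A : ℕ → Fin N → Ω → ℕ) {s t : ℕ} (h : s ≤ t) : past A s ≤ past A t :=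
  biSup_mono fun _ hi => le_trans hi h

lemma measurable_past (A : ℕ → Fin N → Ω → ℕ) (t : ℕ) (j : Fin N) :
    Measurable[past A t] (A t j) := by
  refine Measurable.of_comap_le ?_
  exact le_biSup (fun i : ℕ × Fin N => MeasurableSpace.comap (A i.1 i.2) inferInstance)
    (show ((t, j) : ℕ × Fin N) ∈ {i : ℕ × Fin N | i.1 ≤ t} from le_refl t)

variable [MeasurableSpace Ω]

/-- The law of an arrival sequence. -/
noncomputable def pathLaw (P : Measure Ω) (A : ℕ → Fin N → Ω → ℕ) :
    Measure (ℕ → Fin N → ℕ) :=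
  P.map (future A 0)

/-- The law of the vector of arrivals at one slot boundary. -/
noncomputable def slotLaw (P : Measure Ω) (A : ℕ → Fin N → Ω → ℕ) : Measure (Fin N → ℕ) :=
  P.map (fun ω => future A 0 ω 0)

/-- The arrival sequence `w` has positive probability. -/
def IsLikely (P : Measure Ω) (A : ℕ → Fin N → Ω → ℕ) (w : List (Fin N → ℕ)) : Prop :=
  ∀ v ∈ w, slotLaw P A {v} ≠ 0

variable {lam : Fin N → ℝ} {P : Measure Ω} {A : ℕ → Fin N → Ω → ℕ}

lemma IsLikely.append {w w' : List (Fin N → ℕ)} (h : IsLikely P A w) (h' : IsLikely P A w') :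
    IsLikely P A (w ++ w') := fun v hv => (List.mem_append.1 hv).elim (h v) (h' v)

namespace IsArrivalSystem

lemma past_le (h : IsArrivalSystem lam P A) (t : ℕ) : past A t ≤ ‹MeasurableSpace Ω› :=
  iSup₂_le fun i _ => (h.measurable i.1 i.2).comap_le

lemma rate_lt_one (h : IsArrivalSystem lam P A) (j : Fin N) : lam j < 1 :=
  (Finset.single_le_sum (fun i _ => h.rates.1 i) (Finset.mem_univ j)).trans_lt h.rates.2

lemma measurable_future (h : IsArrivalSystem lam P A) (t : ℕ) : Measurable (future A t) :=
  measurable_pi_lambda _ fun _ => measurable_pi_lambda _ fun _ => h.measurable _ _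

lemma measurable_future_zero (h : IsArrivalSystem lam P A) (t : ℕ) :
    Measurable (fun ω => future A t ω 0) :=
  (measurable_pi_apply 0).comp (h.measurable_future t)

lemma pathLaw_zero (h : IsArrivalSystem lam P A) (B : Set (Fin N → ℕ)) :
    pathLaw P A {a | a 0 ∈ B} = slotLaw P A B := by
  have hB : MeasurableSet B := B.to_countable.measurableSet
  have hB' : MeasurableSet {a : ℕ → Fin N → ℕ | a 0 ∈ B} := measurable_pi_apply 0 hB
  rw [pathLaw, slotLaw, Measure.map_apply (h.measurable_future 0) hB',
    Measure.map_apply (h.measurable_future_zero 0) hB]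
  rfl

variable [IsProbabilityMeasure P]

lemma ae_eq_zero_or_one (h : IsArrivalSystem lam P A) (t : ℕ) (j : Fin N) :
    ∀ᵐ ω ∂P, A t j ω = 0 ∨ A t j ω = 1 := by
  have hm := h.measurable t j
  have h0 : MeasurableSet {ω | A t j ω = 0} := hm (measurableSet_singleton 0)
  have h1 : MeasurableSet {ω | A t j ω = 1} := hm (measurableSet_singleton 1)
  have : P ({ω | A t j ω = 0} ∪ {ω | A t j ω = 1}) = 1 := by
    rw [measure_union _ h1, h.zero, h.one, ← ENNReal.ofReal_add, sub_add_cancel,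
      ENNReal.ofReal_one]
    · linarith [h.rate_lt_one j]
    · exact h.rates.1 j
    · exact Set.disjoint_left.2 fun ω a b => by simp_all
  have h3 := (prob_compl_eq_zero_iff (h0.union h1)).2 this
  exact h3

lemma map_eq (h : IsArrivalSystem lam P A) (t : ℕ) (j : Fin N) :
    P.map (A t j) = P.map (A 0 j) := by
  have key : ∀ s n, P.map (A s j) {n} =
      if n = 0 then ENNReal.ofReal (1 - lam j) else
        if n = 1 then ENNReal.ofReal (lam j) else 0 := by
    intro s n
    rw [Measure.map_apply (h.measurable s j) (measurableSet_singleton n)]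
    split_ifs with h0 h1
    · subst h0; exact h.zero s j
    · subst h1; exact h.one s j
    · refine measure_mono_null (fun ω hω => ?_) (h.ae_eq_zero_or_one s j)
      have hω : A s j ω = n := hω
      simp only [Set.mem_compl_iff, Set.mem_ofPred_eq]
      omega
  exact Measure.ext_of_singleton fun n => by rw [key, key]

lemma measure_arrivals_eq (h : IsArrivalSystem lam P A) (t : ℕ) (v : Fin N → ℕ) :
    P {ω | (fun j => A t j ω) = v} = ∏ j, P.map (A 0 j) {v j} := by
  have hinj : Function.Injective (fun j : Fin N => ((t, j) : ℕ × Fin N)) :=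
    fun a b hh => by simpa using hh
  have hi := (iIndepFun_iff_measure_inter_preimage_eq_mul.1 (h.indep.precomp hinj))
    Finset.univ (sets := fun j => {v j}) (fun _ _ => measurableSet_singleton _)
  have e : {ω | (fun j => A t j ω) = v} = ⋂ j ∈ Finset.univ, A t j ⁻¹' {v j} := by
    ext ω
    simp [funext_iff]
  rw [e]
  refine hi.trans (Finset.prod_congr rfl fun j _ => ?_)
  rw [← h.map_eq t j, Measure.map_apply (h.measurable t j) (measurableSet_singleton _)]

lemma slotLaw_singleton (h : IsArrivalSystem lam P A) (t : ℕ) (v : Fin N → ℕ) :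
    slotLaw P A {v} = P {ω | (fun j => A t j ω) = v} := by
  rw [slotLaw, Measure.map_apply (h.measurable_future_zero 0) (measurableSet_singleton _),
    h.measure_arrivals_eq t, ← h.measure_arrivals_eq 1]
  rfl

/-- An empty slot has positive probability. -/
lemma slotLaw_zero_ne_zero (h : IsArrivalSystem lam P A) : slotLaw P A {0} ≠ 0 := by
  rw [h.slotLaw_singleton 0, h.measure_arrivals_eq]
  refine Finset.prod_ne_zero_iff.2 fun j _ => ?_
  rw [Measure.map_apply (h.measurable 0 j) (measurableSet_singleton _)]
  refine (h.zero 0 j).trans_ne ?_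
  simpa using h.rate_lt_one j

lemma isLikely_zero (h : IsArrivalSystem lam P A) (n : ℕ) :
    IsLikely P A (List.replicate n 0) := fun v hv => by
  rw [List.eq_of_mem_replicate hv]
  exact h.slotLaw_zero_ne_zero

lemma map_future (h : IsArrivalSystem lam P A) (t : ℕ) :
    P.map (future A t) = pathLaw P A := by
  have key : ∀ t, P.map (fun ω (i : ℕ × Fin N) => A (t + 1 + i.1) i.2 ω) =
      Measure.infinitePi (fun i : ℕ × Fin N => P.map (A 0 i.2)) := by
    intro t
    have hinj : Function.Injective (fun i : ℕ × Fin N => ((t + 1 + i.1, i.2) : ℕ × Fin N)) := by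
      rintro ⟨a, b⟩ ⟨c, d⟩ hh
      simp only [Prod.mk.injEq] at hh ⊢
      omega
    rw [(h.indep.precomp hinj).map_fun_eq_infinitePi_map (fun i => h.measurable _ _)]
    simp only [h.map_eq]
  have hc : Measurable (fun (a : ℕ × Fin N → ℕ) (i : ℕ) (j : Fin N) => a (i, j)) := by fun_prop
  have hm : ∀ t, Measurable (fun ω (i : ℕ × Fin N) => A (t + 1 + i.1) i.2 ω) :=
    fun t => measurable_pi_lambda _ fun i => h.measurable _ _
  have := congrArg (Measure.map (fun (a : ℕ × Fin N → ℕ) (i : ℕ) (j : Fin N) => a (i, j)))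
    ((key t).trans (key 0).symm)
  rw [Measure.map_map hc (hm t), Measure.map_map hc (hm 0)] at this
  exact this

/-- The Markov property in its basic form: the arrivals after time `t` are independent of the
past, and their law does not depend on `t`. -/
lemma measure_inter_future (h : IsArrivalSystem lam P A) {t : ℕ} {E : Set Ω}
    (hE : MeasurableSet[past A t] E) {B : Set (ℕ → Fin N → ℕ)} (hB : MeasurableSet B) :
    P (E ∩ future A t ⁻¹' B) = P E * pathLaw P A B := by
  have hdis : Disjoint {i : ℕ × Fin N | i.1 ≤ t} {i : ℕ × Fin N | t < i.1} :=
    Set.disjoint_left.2 fun i hi hi' => by simp only [Set.mem_ofPred_eq] at hi hi'; omega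
  have hi := indep_iSup_of_disjoint (m := fun i : ℕ × Fin N =>
    MeasurableSpace.comap (A i.1 i.2) inferInstance)
    (fun i => (h.measurable i.1 i.2).comap_le) h.indep hdis
  have hf : Measurable[⨆ i ∈ {i : ℕ × Fin N | t < i.1},
      MeasurableSpace.comap (A i.1 i.2) inferInstance] (future A t) := by
    refine @measurable_pi_lambda _ _ _ (_) _ _ fun i =>
      @measurable_pi_lambda _ _ _ (_) _ _ fun j => ?_
    refine Measurable.of_comap_le ?_
    exact le_biSup (fun i : ℕ × Fin N => MeasurableSpace.comap (A i.1 i.2) inferInstance)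
      (show ((t + 1 + i, j) : ℕ × Fin N) ∈ {i : ℕ × Fin N | t < i.1} from
        (by simp only [Set.mem_ofPred_eq]; omega))
  rw [(Indep_iff _ _ _).1 hi E _ hE (hf hB), ← h.map_future t,
    Measure.map_apply (h.measurable_future t) hB]

lemma isProbabilityMeasure_pathLaw (h : IsArrivalSystem lam P A) :
    IsProbabilityMeasure (pathLaw P A) :=
  Measure.isProbabilityMeasure_map (h.measurable_future 0).aemeasurable

lemma isProbabilityMeasure_slotLaw (h : IsArrivalSystem lam P A) :
    IsProbabilityMeasure (slotLaw P A) :=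
  Measure.isProbabilityMeasure_map (h.measurable_future_zero 0).aemeasurable

lemma measure_inter_slot (h : IsArrivalSystem lam P A) {t : ℕ} {E : Set Ω}
    (hE : MeasurableSet[past A t] E) (B : Set (Fin N → ℕ)) :
    P (E ∩ {ω | future A t ω 0 ∈ B}) = P E * slotLaw P A B := by
  rw [← h.pathLaw_zero]
  exact h.measure_inter_future hE (measurable_pi_apply 0 B.to_countable.measurableSet)

lemma lintegral_inter_slot (h : IsArrivalSystem lam P A) {t : ℕ} {E : Set Ω}
    (hE : MeasurableSet[past A t] E) (g : (Fin N → ℕ) → ℝ≥0∞) :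
    ∫⁻ ω in E, g (future A t ω 0) ∂P = P E * ∫⁻ v, g v ∂(slotLaw P A) := by
  have hm := h.measurable_future_zero t
  have : (P.restrict E).map (fun ω => future A t ω 0) = P E • slotLaw P A := by
    refine Measure.ext fun B hB => ?_
    rw [Measure.map_apply hm hB, Measure.restrict_apply (hm hB), Set.inter_comm]
    exact h.measure_inter_slot hE B
  rw [← lintegral_map (f := g) .of_discrete hm, this, lintegral_smul_measure, smul_eq_mul]

lemma lintegral_slot_total (h : IsArrivalSystem lam P A) :
    ∫⁻ v, ((∑ j, v j : ℕ) : ℝ≥0∞) ∂(slotLaw P A) = ENNReal.ofReal (∑ j, lam j) := by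
  have hm := h.measurable_future_zero 0
  rw [slotLaw, lintegral_map .of_discrete hm]
  simp only [Nat.cast_sum]
  rw [lintegral_finsetSum', ENNReal.ofReal_sum_of_nonneg fun j _ => h.rates.1 j]
  · refine Finset.sum_congr rfl fun j _ => ?_
    have h1 : MeasurableSet {ω | A 1 j ω = 1} := h.measurable 1 j (measurableSet_singleton 1)
    rw [← h.one 1 j, ← lintegral_indicator_one h1]
    refine lintegral_congr_ae ?_
    filter_upwards [h.ae_eq_zero_or_one 1 j] with ω hω
    rcases hω with hω | hω <;> simp [future, hω]
  · intro j _
    exact (Measurable.comp (g := fun n : ℕ => (n : ℝ≥0∞)) .of_discrete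
      (h.measurable 1 j)).aemeasurable

end IsArrivalSystem

end Arrivals

/-! ### Deterministic dynamics -/

section Dynamics

variable {N : ℕ} [NeZero N]

/-- The state after `t` slots, started from `x` and driven by the arrival sequence `a`. -/
def run (x : State N) (a : ℕ → Fin N → ℕ) : ℕ → State N
  | 0 => x
  | t + 1 => step (run x a t) (a t)

/-- The incumbent is empty: the server is about to move on. -/
def IsPolled (x : State N) : Prop := x.1 x.2 = 0

/-- The total number of packets in the system. -/
def total (x : State N) : ℕ := ∑ j, x.1 j

/-- The number of moves that take the server from queue `u` to queue `j`. -/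
def gap (u j : Fin N) : ℕ := (j - u).val

/-- The number of polling instants during the slots `0, …, |w| - 1` of the run from `x` driven by
the finite arrival sequence `w`. -/
noncomputable def pollCount : State N → List (Fin N → ℕ) → ℕ
  | _, [] => 0
  | x, v :: w => (open Classical in if IsPolled x then 1 else 0) + pollCount (step x v) w

lemma pollCount_append (x : State N) (w w' : List (Fin N → ℕ)) :
    pollCount x (w ++ w') = pollCount x w + pollCount (w.foldl step x) w' := by
  induction w generalizing x with
  | nil => simp [pollCount]
  | cons v w ih => simp [pollCount, ih, add_assoc]

lemma cyclicExhaustive_of_pos {x : State N} (h : 0 < x.1 x.2) : cyclicExhaustive x = x.2 :=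
  if_pos h

lemma cyclicExhaustive_of_isPolled {x : State N} (h : IsPolled x) :
    cyclicExhaustive x = x.2 + 1 := by
  have h : x.1 x.2 = 0 := h
  simp [cyclicExhaustive, h]

lemma gap_succ {u j : Fin N} (h : u ≠ j) : gap (u + 1) j + 1 = gap u j := by
  have h0 : j - u ≠ 0 := sub_ne_zero.2 h.symm
  have h1 : (j - u).val ≠ 0 := fun e => h0 (Fin.ext (by simpa using e))
  rw [gap, gap, ← sub_sub, Fin.val_sub_one_of_ne_zero h0]
  omega

lemma le_step (x : State N) (v : Fin N → ℕ) (j : Fin N) : x.1 j ≤ (step x v).1 j + 1 := by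
  simp only [step]
  split_ifs <;> omega

lemma total_step_le (x : State N) (v : Fin N → ℕ) :
    total (step x v) ≤ total x + ∑ j, v j := by
  simp only [total, step, Finset.sum_add_distrib]
  gcongr
  exact Nat.sub_le _ _

lemma total_step_add_one {x : State N} (v : Fin N → ℕ) (h : 0 < x.1 (cyclicExhaustive x)) :
    total (step x v) + 1 = total x + ∑ j, v j := by
  have h1 : ∑ j, (x.1 j - if j = cyclicExhaustive x then 1 else 0) +
      ∑ j, (if j = cyclicExhaustive x then 1 else 0) = ∑ j, x.1 j := by
    rw [← Finset.sum_add_distrib]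
    refine Finset.sum_congr rfl fun j _ => ?_
    split_ifs with e
    · subst e; omega
    · omega
  rw [Finset.sum_ite_eq' Finset.univ (cyclicExhaustive x) (fun _ => 1),
    if_pos (Finset.mem_univ _)] at h1
  simp only [total, step, Finset.sum_add_distrib]
  omega

/-- As long as queue `j` is nonempty, the total queue length plus the distance of the server from
`j` loses one per slot, up to the arrivals: either a packet is served or the server comes one
queue closer to `j`. -/
lemma total_add_gap_step {x : State N} {j : Fin N} (v : Fin N → ℕ) (h : 0 < x.1 j) :
    total (step x v) + gap (step x v).2 j + 1 ≤ total x + ∑ i, v i + gap x.2 j := by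
  have e2 : (step x v).2 = cyclicExhaustive x := rfl
  by_cases hu : 0 < x.1 x.2
  · have hc := cyclicExhaustive_of_pos hu
    have := total_step_add_one v (x := x) (by rwa [hc])
    rw [e2, hc]
    omega
  · have hp : IsPolled x := by simpa [IsPolled] using hu
    have hc := cyclicExhaustive_of_isPolled hp
    have hne : x.2 ≠ j := fun e => hu (by rwa [e])
    have := total_step_le x v
    have := gap_succ hne
    rw [e2, hc]
    omega

lemma step_zero_fst_le (x : State N) (j : Fin N) : (step x 0).1 j ≤ x.1 j := by
  simp [step]

lemma step_zero_zero (u : Fin N) : step ((0, u) : State N) 0 = (0, u + 1) := by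
  have : cyclicExhaustive ((0, u) : State N) = u + 1 :=
    cyclicExhaustive_of_isPolled (by simp [IsPolled])
  refine Prod.ext ?_ this
  funext j
  simp [step]

/-- Without arrivals the system empties. -/
lemma exists_foldl_zero_eq_zero (x : State N) :
    ∃ n u, (List.replicate n (0 : Fin N → ℕ)).foldl step x = (0, u) := by
  by_cases h0 : x.1 = 0
  · exact ⟨0, x.2, by simp [← h0]⟩
  obtain ⟨j, hj⟩ := Function.ne_iff.1 h0
  -- `N * total x` plus the distance to a fixed nonempty queue decreases; when that queue
  -- becomes empty another one is chosen, and then the total has decreased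
  have key : ∀ m d, ∀ x : State N, ∀ j, total x = m → gap x.2 j = d → 0 < x.1 j →
      ∃ n u, (List.replicate n (0 : Fin N → ℕ)).foldl step x = (0, u) := by
    intro m
    induction m using Nat.strong_induction_on with
    | _ m ihm =>
      intro d
      induction d with
      | zero =>
        intro x j hm hd hj
        have h1 := total_add_gap_step 0 hj
        simp only [Pi.zero_apply, Finset.sum_const_zero, add_zero] at h1
        by_cases h0 : (step x 0).1 = 0
        · exact ⟨1, (step x 0).2, Prod.ext h0 rfl⟩
        obtain ⟨i, hi⟩ := Function.ne_iff.1 h0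
        obtain ⟨n, u, hn⟩ := ihm (total (step x 0)) (by omega) (gap (step x 0).2 i) _ i rfl rfl
          (Nat.pos_of_ne_zero hi)
        exact ⟨n + 1, u, by simpa [List.replicate_succ] using hn⟩
      | succ d ihd =>
        intro x j hm hd hj
        have h1 := total_add_gap_step 0 hj
        have h2 := total_step_le x 0
        simp only [Pi.zero_apply, Finset.sum_const_zero, add_zero] at h1 h2
        by_cases h0 : (step x 0).1 = 0
        · exact ⟨1, (step x 0).2, Prod.ext h0 rfl⟩
        obtain ⟨i, hi⟩ := Function.ne_iff.1 h0
        rcases h2.lt_or_eq with h3 | h3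
        · obtain ⟨n, u, hn⟩ := ihm (total (step x 0)) (by omega) (gap (step x 0).2 i) _ i rfl rfl
            (Nat.pos_of_ne_zero hi)
          exact ⟨n + 1, u, by simpa [List.replicate_succ] using hn⟩
        · have hj' : 0 < (step x 0).1 j := by
            have : (step x 0).1 j = x.1 j :=
              (Finset.sum_eq_sum_iff_of_le fun i _ => step_zero_fst_le x i).1 h3 j
                (Finset.mem_univ j)
            omega
          have hg : gap (step x 0).2 j = d := by
            by_cases hu : 0 < x.1 x.2
            · have := total_step_add_one 0 (x := x) (by rwa [cyclicExhaustive_of_pos hu])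
              simp only [Pi.zero_apply, Finset.sum_const_zero, add_zero] at this
              omega
            · have hc : (step x 0).2 = x.2 + 1 :=
                cyclicExhaustive_of_isPolled (by simpa [IsPolled] using hu)
              have := gap_succ (fun e => hu (by rwa [e]) : x.2 ≠ j)
              rw [hc]
              omega
          obtain ⟨n, u, hn⟩ := ihd _ j (h3.trans hm) hg hj'
          exact ⟨n + 1, u, by simpa [List.replicate_succ] using hn⟩
  exact key _ _ x j rfl rfl (Nat.pos_of_ne_zero hj)

lemma foldl_zero_zero (u : Fin N) (n : ℕ) :
    (List.replicate n (0 : Fin N → ℕ)).foldl step ((0, u) : State N) = (0, u + n • 1) := by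
  induction n generalizing u with
  | zero => simp
  | succ n ih =>
    rw [List.replicate_succ, List.foldl_cons, step_zero_zero, ih, succ_nsmul', add_assoc]

lemma val_nsmul_one (k : ℕ) : (k • (1 : Fin N)).val = k % N := by
  induction k with
  | zero => simp
  | succ k ih => rw [succ_nsmul, Fin.val_add, ih, Fin.val_one', ← Nat.add_mod]

lemma val_nsmul_one_self (u : Fin N) : u.val • (1 : Fin N) = u :=
  Fin.ext (by rw [val_nsmul_one, Nat.mod_eq_of_lt u.isLt])

lemma nsmul_one_eq_nsmul_one {k l : ℕ} : k • (1 : Fin N) = l • 1 ↔ k ≡ l [MOD N] := by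
  rw [Fin.ext_iff, val_nsmul_one, val_nsmul_one, Nat.ModEq]

lemma exists_foldl_zero_eq (x : State N) (u : Fin N) :
    ∃ n, (List.replicate n (0 : Fin N → ℕ)).foldl step x = (0, u) := by
  obtain ⟨n, u', h⟩ := exists_foldl_zero_eq_zero x
  refine ⟨n + (u - u').val, ?_⟩
  rw [List.replicate_add, List.foldl_append, h, foldl_zero_zero, val_nsmul_one_self, add_sub_cancel]

lemma pollCount_zero_zero (u : Fin N) (n : ℕ) :
    pollCount ((0, u) : State N) (List.replicate n 0) = n := by
  induction n generalizing u with
  | zero => rfl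
  | succ n ih =>
    have : IsPolled ((0, u) : State N) := by simp [IsPolled]
    rw [List.replicate_succ, pollCount, step_zero_zero, ih, if_pos this, add_comm]

lemma measurable_run (x : State N) (t : ℕ) : Measurable fun a => run x a t := by
  induction t with
  | zero => exact measurable_const
  | succ t ih =>
    exact Measurable.comp (g := fun p : State N × (Fin N → ℕ) => step p.1 p.2) .of_discrete
      (ih.prodMk (measurable_pi_apply t))

variable {Ω : Type*} (A : ℕ → Fin N → Ω → ℕ) (u₀ : Fin N)

lemma process_succ (t : ℕ) (ω : Ω) :
    process A u₀ (t + 1) ω = step (process A u₀ t ω) (future A t ω 0) := rfl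

lemma process_add (t s : ℕ) (ω : Ω) :
    process A u₀ (t + s) ω = run (process A u₀ t ω) (future A t ω) s := by
  induction s with
  | zero => rfl
  | succ s ih =>
    rw [run, ← ih]
    refine congrArg (step (process A u₀ (t + s) ω)) (funext fun j => ?_)
    rw [future, add_right_comm]
    rfl

lemma measurable_process (t : ℕ) : Measurable[past A t] (process A u₀ t) := by
  induction t with
  | zero =>
    exact @Measurable.prodMk _ _ _ _ _ (_) _ _ (@measurable_pi_lambda _ _ _ (_) _ _ fun j =>
      measurable_past A 0 j) (@measurable_const _ _ _ (_) _)
  | succ t ih =>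
    have h1 : Measurable[past A (t + 1)] (process A u₀ t) :=
      ih.mono (past_mono A (Nat.le_succ t)) le_rfl
    have h2 : Measurable[past A (t + 1)] (fun ω j => A (t + 1) j ω) :=
      @measurable_pi_lambda _ _ _ (_) _ _ fun j => measurable_past A (t + 1) j
    exact Measurable.comp (g := fun p : State N × (Fin N → ℕ) => step p.1 p.2) .of_discrete
      (@Measurable.prodMk _ _ _ _ _ (_) _ _ h1 h2)

lemma measurableSet_process {t r : ℕ} (h : t ≤ r) (S : Set (State N)) :
    MeasurableSet[past A r] {ω | process A u₀ t ω ∈ S} :=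
  past_mono A h _ (measurable_process A u₀ t S.to_countable.measurableSet)

/-- The arrivals after time `t` start with the finite sequence `w`. -/
def Follows (ω : Ω) : ℕ → List (Fin N → ℕ) → Prop
  | _, [] => True
  | t, v :: w => future A t ω 0 = v ∧ Follows ω (t + 1) w

open Classical in
lemma count_isPolled_succ (ω : Ω) (t : ℕ) :
    Nat.count (IsPollingInstant A u₀ ω) (t + 1) = Nat.count (IsPollingInstant A u₀ ω) t +
      if IsPolled (process A u₀ t ω) then 1 else 0 :=
  Nat.count_succ _ _

variable {A u₀}

lemma Follows.process_eq {ω : Ω} {t : ℕ} {w : List (Fin N → ℕ)} (h : Follows A ω t w) :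
    process A u₀ (t + w.length) ω = w.foldl step (process A u₀ t ω) := by
  induction w generalizing t with
  | nil => rfl
  | cons v w ih =>
    rw [List.foldl_cons, List.length_cons, ← h.1, ← process_succ, ← ih h.2,
      add_assoc, add_comm 1]

open Classical in
lemma Follows.count_eq {ω : Ω} {t : ℕ} {w : List (Fin N → ℕ)} (h : Follows A ω t w) :
    Nat.count (IsPollingInstant A u₀ ω) (t + w.length) =
      Nat.count (IsPollingInstant A u₀ ω) t + pollCount (process A u₀ t ω) w := by
  induction w generalizing t with
  | nil => rfl
  | cons v w ih =>
    rw [List.length_cons, ← add_assoc, add_right_comm, ih h.2, count_isPolled_succ, pollCount,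
      ← h.1, ← process_succ, add_assoc]

open Classical in
/-- The position of the server determines the number of past polling instants modulo `N`. -/
lemma process_snd_eq (ω : Ω) (t : ℕ) :
    (process A u₀ t ω).2 = u₀ + Nat.count (IsPollingInstant A u₀ ω) t • (1 : Fin N) := by
  induction t with
  | zero => simp [process]
  | succ t ih =>
    rw [count_isPolled_succ, process_succ]
    change cyclicExhaustive (process A u₀ t ω) = _
    split_ifs with hp
    · rw [cyclicExhaustive_of_isPolled hp, ih, succ_nsmul, add_assoc]
    · rw [cyclicExhaustive_of_pos (Nat.pos_of_ne_zero hp), ih, add_zero]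

end Dynamics

/-! ### A Lyapunov function -/

section Lyapunov

variable {N : ℕ} [NeZero N] {Ω : Type*} [MeasurableSpace Ω]

/-- The transition operator of the chain: the mean of `g` one slot after the state `x`. -/
noncomputable def mean (P : Measure Ω) (A : ℕ → Fin N → Ω → ℕ) (g : State N → ℝ≥0∞)
    (x : State N) : ℝ≥0∞ :=
  ∫⁻ v, g (step x v) ∂(slotLaw P A)

/-- The probability that the chain started from `x` avoids `z` at the times `0, …, k`. -/
noncomputable def avoid (P : Measure Ω) (A : ℕ → Fin N → Ω → ℕ) (z : State N) :
    ℕ → State N → ℝ≥0∞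
  | 0, x => open Classical in if x = z then 0 else 1
  | k + 1, x => open Classical in if x = z then 0 else mean P A (avoid P A z k) x

variable {lam : Fin N → ℝ} {P : Measure Ω} {A : ℕ → Fin N → Ω → ℕ}

lemma mean_mono {g g' : State N → ℝ≥0∞} (h : ∀ x, g x ≤ g' x) (x : State N) :
    mean P A g x ≤ mean P A g' x :=
  lintegral_mono fun _ => h _

lemma mean_add (g g' : State N → ℝ≥0∞) (x : State N) :
    mean P A (fun y => g y + g' y) x = mean P A g x + mean P A g' x :=
  lintegral_add_left .of_discrete _

lemma mean_sum (g : ℕ → State N → ℝ≥0∞) (n : ℕ) (x : State N) :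
    mean P A (fun y => ∑ i ∈ Finset.range n, g i y) x = ∑ i ∈ Finset.range n, mean P A (g i) x :=
  lintegral_finsetSum _ fun _ _ => .of_discrete

lemma mean_const_mul (c : ℝ≥0∞) (g : State N → ℝ≥0∞) (x : State N) :
    mean P A (fun y => c * g y) x = c * mean P A g x :=
  lintegral_const_mul _ .of_discrete

lemma avoid_self (z : State N) (k : ℕ) : avoid P A z k z = 0 := by
  cases k <;> simp [avoid]

lemma avoid_succ_of_ne {x z : State N} (h : x ≠ z) (k : ℕ) :
    avoid P A z (k + 1) x = mean P A (avoid P A z k) x := by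
  simp [avoid, h]

lemma avoid_zero_of_ne {x z : State N} (h : x ≠ z) : avoid P A z 0 x = 1 := by
  simp [avoid, h]

namespace IsArrivalSystem

variable [IsProbabilityMeasure P]

lemma mean_const (h : IsArrivalSystem lam P A) (c : ℝ≥0∞) (x : State N) :
    mean P A (fun _ => c) x = c := by
  have := h.isProbabilityMeasure_slotLaw
  simp [mean]

lemma avoid_succ_le (h : IsArrivalSystem lam P A) (z : State N) (k : ℕ) (x : State N) :
    avoid P A z (k + 1) x ≤ avoid P A z k x := by
  induction k generalizing x with
  | zero =>
    by_cases e : x = z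
    · subst e; simp [avoid_self]
    rw [avoid_succ_of_ne e, avoid_zero_of_ne e, ← h.mean_const 1 x]
    refine mean_mono (fun y => ?_) x
    unfold avoid
    split_ifs <;> simp
  | succ k ih =>
    by_cases e : x = z
    · subst e; simp [avoid_self]
    rw [avoid_succ_of_ne e, avoid_succ_of_ne e]
    exact mean_mono ih x

lemma avoid_antitone (h : IsArrivalSystem lam P A) (z x : State N) :
    Antitone fun k => avoid P A z k x :=
  antitone_nat_of_succ_le fun k => h.avoid_succ_le z k x

lemma avoid_le_one (h : IsArrivalSystem lam P A) (z : State N) (k : ℕ) (x : State N) :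
    avoid P A z k x ≤ 1 :=
  (h.avoid_antitone z x (Nat.zero_le k)).trans (by simp only [avoid]; split_ifs <;> simp)

lemma avoid_lt_one (h : IsArrivalSystem lam P A) {z : State N} {w : List (Fin N → ℕ)}
    (hw : IsLikely P A w) {x : State N} (hx : w.foldl step x = z) :
    avoid P A z w.length x < 1 := by
  have := h.isProbabilityMeasure_slotLaw
  induction w generalizing x with
  | nil => subst hx; simp [avoid_self]
  | cons v w ih =>
    by_cases e : x = z
    · subst e; simp [avoid_self]
    rw [List.length_cons, avoid_succ_of_ne e, ← h.mean_const 1 x]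
    refine lintegral_strict_mono_of_ae_le_of_ae_lt_on (s := {v}) aemeasurable_const ?_
      (.of_forall fun _ => h.avoid_le_one _ _ _) (hw v (by simp)) (.of_forall fun v' hv' => ?_)
    · refine ne_top_of_le_ne_top ENNReal.one_ne_top ?_
      rw [← h.mean_const 1 x]
      exact mean_mono (h.avoid_le_one z w.length) x
    · rw [Set.mem_singleton_iff.1 hv']
      exact ih (fun u hu => hw u (by simp [hu])) hx

lemma mean_total_le (h : IsArrivalSystem lam P A) (n : ℕ) (x : State N) :
    (mean P A)^[n] (fun y => (total y : ℝ≥0∞)) x ≤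
      total x + n * ENNReal.ofReal (∑ j, lam j) := by
  induction n generalizing x with
  | zero => simp
  | succ n ih =>
    have := h.isProbabilityMeasure_slotLaw
    rw [Function.iterate_succ_apply']
    calc _ ≤ mean P A (fun y => total y + n * ENNReal.ofReal (∑ j, lam j)) x := mean_mono ih x
      _ = mean P A (fun y => (total y : ℝ≥0∞)) x + n * ENNReal.ofReal (∑ j, lam j) := by
        rw [mean_add, h.mean_const]
      _ ≤ (total x + ENNReal.ofReal (∑ j, lam j)) + n * ENNReal.ofReal (∑ j, lam j) := by
        gcongr
        calc _ ≤ ∫⁻ v, ((total x : ℝ≥0∞) + (∑ j, v j : ℕ)) ∂(slotLaw P A) :=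
              lintegral_mono fun v => by
                exact (Nat.cast_le.2 (total_step_le x v)).trans_eq (Nat.cast_add _ _)
          _ = _ := by
            rw [lintegral_add_left measurable_const, h.lintegral_slot_total]
            simp
      _ = _ := by push_cast; ring

/-- The drift of the total queue length over `n` slots, from a state with a queue that cannot
empty in the meantime: only as many slots are wasted as it takes the server to reach that queue. -/
lemma mean_total_add_le (h : IsArrivalSystem lam P A) (n : ℕ) {x : State N} {j : Fin N}
    (hj : n ≤ x.1 j) :
    (mean P A)^[n] (fun y => (total y : ℝ≥0∞)) x + n ≤
      total x + gap x.2 j + n * ENNReal.ofReal (∑ j, lam j) := by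
  induction n generalizing x with
  | zero => simp
  | succ n ih =>
    have := h.isProbabilityMeasure_slotLaw
    set ρ := ENNReal.ofReal (∑ j, lam j)
    rw [Function.iterate_succ_apply']
    calc _ = ∫⁻ v, ((mean P A)^[n] (fun y => (total y : ℝ≥0∞)) (step x v) + n + 1)
            ∂(slotLaw P A) := by
          rw [lintegral_add_left .of_discrete, lintegral_add_left .of_discrete]
          simp [mean, add_assoc]
      _ ≤ ∫⁻ v, (((total x + gap x.2 j : ℕ) : ℝ≥0∞) + n * ρ + (∑ i, v i : ℕ))
            ∂(slotLaw P A) := lintegral_mono fun v => by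
          have h1 := ih (x := step x v) (by have := le_step x v j; omega)
          have h2 := total_add_gap_step v (by omega : 0 < x.1 j)
          have h3 : ((total (step x v) + gap (step x v).2 j + 1 : ℕ) : ℝ≥0∞) ≤
            ((total x + ∑ i, v i + gap x.2 j : ℕ) : ℝ≥0∞) := by exact_mod_cast h2
          calc _ ≤ total (step x v) + gap (step x v).2 j + n * ρ + 1 := by gcongr
            _ = ((total (step x v) + gap (step x v).2 j + 1 : ℕ) : ℝ≥0∞) + n * ρ := by
              push_cast; ring
            _ ≤ _ := by
              refine (add_le_add_left h3 _).trans_eq ?_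
              push_cast; ring
      _ = _ := by
        rw [lintegral_add_left measurable_const, h.lintegral_slot_total]
        simp only [lintegral_const, measure_univ, mul_one]
        push_cast
        ring

/-- A Lyapunov function whose mean decreases by at least one in every slot that does not start
in the given state `z`. -/
lemma exists_lyapunov (h : IsArrivalSystem lam P A) {z : State N}
    (hz : ∀ x, ∃ w, IsLikely P A w ∧ w.foldl step x = z) :
    ∃ U : State N → ℝ≥0∞, (∀ x, mean P A U x ≠ ∞) ∧ ∀ x, x ≠ z → mean P A U x + 1 ≤ U x := by
  set ρ := ENNReal.ofReal (∑ j, lam j)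
  have hρt : ρ ≠ ∞ := ENNReal.ofReal_ne_top
  set V : State N → ℝ≥0∞ := fun y => (total y : ℝ≥0∞)
  -- the horizon `T` is so long that the capacity left over exceeds the slots wasted
  obtain ⟨T, hT⟩ : ∃ T : ℕ, (T : ℝ≥0∞) * ρ + N + 1 ≤ T := by
    have hl := h.rates.2
    have hl0 : 0 ≤ ∑ j, lam j := Finset.sum_nonneg fun j _ => h.rates.1 j
    obtain ⟨T, hT⟩ := exists_nat_ge ((N + 1) / (1 - ∑ j, lam j))
    refine ⟨T, ?_⟩
    rw [div_le_iff₀ (by linarith)] at hT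
    have : (T : ℝ) * (∑ j, lam j) + N + 1 ≤ T := by linarith
    have h2 := ENNReal.ofReal_le_ofReal this
    rwa [ENNReal.ofReal_add (by positivity) (by norm_num), ENNReal.ofReal_add (by positivity)
      (by positivity), ENNReal.ofReal_mul (by positivity), ENNReal.ofReal_natCast,
      ENNReal.ofReal_natCast, ENNReal.ofReal_one] at h2
  set C : Set (State N) := {x | ∀ j, x.1 j < T}
  have hC : C.Finite := by
    have : (Set.univ.pi fun _ : Fin N => Set.Iio T).Finite :=
      Set.Finite.pi fun _ => Set.finite_Iio T
    refine (this.prod Set.finite_univ).subset fun x hx => ⟨fun j _ => hx j, trivial⟩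
  choose w hw hwz using hz
  set L := ∑ x ∈ hC.toFinset, (w x).length
  have hL : ∀ x ∈ C, avoid P A z L x < 1 := fun x hx =>
    (h.avoid_antitone z x (Finset.single_le_sum (f := fun x => (w x).length)
      (fun _ _ => Nat.zero_le _) (hC.mem_toFinset.2 hx))).trans_lt (h.avoid_lt_one (hw x) (hwz x))
  -- the weight `c` lets the chance of reaching `z` outweigh the arrivals on the finite set `C`
  set c : ℝ≥0∞ := ∑ x ∈ hC.toFinset, (T * ρ + 1) / (1 - avoid P A z L x)
  have hct : c ≠ ∞ := ENNReal.sum_ne_top.2 fun x hx =>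
    ENNReal.div_ne_top (by finiteness) (tsub_pos_of_lt (hL x (hC.mem_toFinset.1 hx))).ne'
  have hc : ∀ x ∈ C, c * avoid P A z L x + (T * ρ + 1) ≤ c := by
    intro x hx
    have h1 : (T * ρ + 1) / (1 - avoid P A z L x) ≤ c :=
      Finset.single_le_sum (f := fun x => (T * ρ + 1) / (1 - avoid P A z L x))
        (fun _ _ => zero_le) (hC.mem_toFinset.2 hx)
    have h2 : T * ρ + 1 ≤ c * (1 - avoid P A z L x) := by
      rwa [ENNReal.div_le_iff (tsub_pos_of_lt (hL x hx)).ne' (by finiteness)] at h1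
    calc _ ≤ c * avoid P A z L x + c * (1 - avoid P A z L x) := by gcongr
      _ = c := by rw [← mul_add, add_tsub_cancel_of_le (hL x hx).le, mul_one]
  set W : State N → ℝ≥0∞ := fun x => ∑ i ∈ Finset.range T, (mean P A)^[i] V x
  set J : State N → ℝ≥0∞ := fun x => ∑ k ∈ Finset.range L, avoid P A z k x
  have hW : ∀ x, mean P A W x + V x = W x + (mean P A)^[T] V x := by
    intro x
    have e : mean P A W x = ∑ i ∈ Finset.range T, (mean P A)^[i + 1] V x := by
      rw [mean_sum]
      simp only [Function.iterate_succ_apply']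
    rw [e]
    exact (Finset.sum_range_succ' (fun i => (mean P A)^[i] V x) T).symm.trans
      (Finset.sum_range_succ _ T)
  have hJ : ∀ x, x ≠ z → mean P A J x + 1 = J x + avoid P A z L x := by
    intro x hx
    have e : mean P A J x = ∑ k ∈ Finset.range L, avoid P A z (k + 1) x := by
      rw [mean_sum]
      simp only [avoid_succ_of_ne hx]
    rw [e, ← avoid_zero_of_ne (P := P) (A := A) hx]
    exact (Finset.sum_range_succ' (fun k => avoid P A z k x) L).symm.trans
      (Finset.sum_range_succ _ L)
  have hU : ∀ x, mean P A (fun y => W y + c * J y) x = mean P A W x + c * mean P A J x := by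
    intro x
    rw [mean_add, mean_const_mul]
  refine ⟨fun y => W y + c * J y, fun x => ?_, fun x hx => ?_⟩
  · have h1 : mean P A W x ≠ ∞ := by
      refine ne_top_of_le_ne_top (b := W x + (mean P A)^[T] V x) ?_ (hW x ▸ le_self_add)
      have hm : ∀ n, (mean P A)^[n] V x ≠ ∞ := fun n =>
        ne_top_of_le_ne_top (by finiteness) (h.mean_total_le n x)
      exact ENNReal.add_ne_top.2 ⟨ENNReal.sum_ne_top.2 fun i _ => hm i, hm T⟩
    have h2 : mean P A J x ≠ ∞ := by
      refine ne_top_of_le_ne_top (b := (L : ℝ≥0∞)) (by finiteness) ?_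
      rw [← h.mean_const L x]
      refine mean_mono (fun y => ?_) x
      refine (Finset.sum_le_sum fun k _ => h.avoid_le_one z k y).trans_eq (by simp)
    rw [hU]
    finiteness
  · have hd : (mean P A)^[T] V x + c * avoid P A z L x + 1 ≤ V x + c := by
      by_cases hxC : x ∈ C
      · calc _ ≤ V x + T * ρ + c * avoid P A z L x + 1 := by
              gcongr
              exact h.mean_total_le T x
          _ = V x + (c * avoid P A z L x + (T * ρ + 1)) := by ring
          _ ≤ _ := by gcongr; exact hc x hxC
      · obtain ⟨j, hj⟩ : ∃ j, T ≤ x.1 j := by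
          by_contra! h'
          exact hxC h'
        have h1 := h.mean_total_add_le T hj
        have hg : (gap x.2 j : ℝ≥0∞) ≤ N := by exact_mod_cast (j - x.2).isLt.le
        have h2 : (mean P A)^[T] V x + 1 ≤ V x := by
          have h3 : (mean P A)^[T] V x + 1 + (T * ρ + N) ≤ V x + (T * ρ + N) :=
            calc _ = (mean P A)^[T] V x + (T * ρ + N + 1) := by ring
              _ ≤ (mean P A)^[T] V x + T := by gcongr
              _ ≤ _ := h1
              _ ≤ V x + N + T * ρ := by gcongr
              _ = _ := by ring
          exact (ENNReal.add_le_add_iff_right (by finiteness)).1 h3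
        calc _ = (mean P A)^[T] V x + 1 + c * avoid P A z L x := by ring
          _ ≤ V x + c * 1 := by gcongr; exact h.avoid_le_one z L x
          _ = _ := by rw [mul_one]
    have hfin : V x + c ≠ ∞ := ENNReal.add_ne_top.2 ⟨ENNReal.natCast_ne_top _, hct⟩
    refine (ENNReal.add_le_add_iff_right hfin).1 ?_
    rw [hU]
    calc _ = (mean P A W x + V x) + c * (mean P A J x + 1) + 1 := by ring
      _ = W x + c * J x + ((mean P A)^[T] V x + c * avoid P A z L x + 1) := by
        rw [hW, hJ x hx]; ring
      _ ≤ _ := by gcongr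

end IsArrivalSystem

end Lyapunov

/-! ### The state process -/

section StateChain

open Classical in
/-- The return time is the number of times `k` such that the state is not visited during the
first `k` steps. -/
lemma returnTime_le_tsum {Ω S : Type*} (X : ℕ → Ω → S) (z : S) (t : ℕ) (ω : Ω) :
    returnTime X z t ω ≤
      ∑' k, Set.indicator {ω | ∀ i < k, X (t + (i + 1)) ω ≠ z} (fun _ => 1) ω := by
  by_cases h : ∃ i, X (t + (i + 1)) ω = z
  · have h1 : returnTime X z t ω ≤ ((Nat.find h + 1 : ℕ) : ℝ≥0∞) :=
      iInf₂_le _ ⟨Nat.succ_pos _, Nat.find_spec h⟩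
    refine h1.trans ?_
    refine le_trans ?_ (ENNReal.sum_le_tsum (Finset.range (Nat.find h + 1)))
    rw [Finset.sum_congr rfl (g := fun _ => 1)]
    · simp
    · intro k hk
      refine Set.indicator_of_mem ?_ _
      exact fun i hi => Nat.find_min h (hi.trans_le (Nat.lt_succ_iff.1 (Finset.mem_range.1 hk)))
  · push Not at h
    rw [tsum_congr (g := fun _ => 1)]
    · simp
    · intro k
      refine Set.indicator_of_mem ?_ _
      exact fun i _ => h i

variable {N : ℕ} {Ω : Type*} [MeasurableSpace Ω]
  {lam : Fin N → ℝ} {P : Measure Ω} {A : ℕ → Fin N → Ω → ℕ}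

/-- A nonnull set that is covered by countably many sets has a nonnull intersection with one of
them. -/
lemma exists_measure_inter_ne_zero {ι : Type*} [Countable ι] {E : Set Ω} (hE : P E ≠ 0)
    {F : ι → Set Ω} (h : ∀ ω ∈ E, ∃ i, ω ∈ F i) : ∃ i, P (E ∩ F i) ≠ 0 := by
  by_contra! h0
  refine hE (measure_mono_null (fun ω hω => ?_) (measure_iUnion_null h0))
  obtain ⟨i, hi⟩ := h ω hω
  exact Set.mem_iUnion.2 ⟨i, hω, hi⟩

namespace IsArrivalSystem

/-- A likely arrival sequence has positive probability conditionally on every past. -/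
lemma measure_follows_ne_zero [IsProbabilityMeasure P] (h : IsArrivalSystem lam P A) {t : ℕ}
    {E : Set Ω} (hE : MeasurableSet[past A t] E) (hE0 : P E ≠ 0) {w : List (Fin N → ℕ)}
    (hw : IsLikely P A w) : P (E ∩ {ω | Follows A ω t w}) ≠ 0 := by
  induction w generalizing t E with
  | nil => simpa [Follows] using hE0
  | cons v w ih =>
    have hm : MeasurableSet[past A (t + 1)] {ω | future A t ω 0 = v} :=
      (@measurable_pi_lambda _ _ _ (_) _ _ fun j => measurable_past A (t + 1) j :
        Measurable[past A (t + 1)] (fun ω => future A t ω 0)) (measurableSet_singleton v)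
    have h1 : P (E ∩ {ω | future A t ω 0 = v}) ≠ 0 := by
      have := h.measure_inter_slot hE {v}
      simp only [Set.mem_singleton_iff] at this
      rw [this]
      exact mul_ne_zero hE0 (hw v (by simp))
    have := ih (MeasurableSet.inter (past_mono A (Nat.le_succ t) _ hE) hm) h1
      (fun u hu => hw u (by simp [hu]))
    rwa [Set.inter_assoc] at this

variable [NeZero N] (u₀ : Fin N)

lemma measurableSet_process_eq (h : IsArrivalSystem lam P A) (t : ℕ) (x : State N) :
    MeasurableSet {ω | process A u₀ t ω = x} :=
  h.past_le t _ (measurableSet_process A u₀ le_rfl {x})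

variable [IsProbabilityMeasure P]

lemma isMarkovChain_process (h : IsArrivalSystem lam P A) : IsMarkovChain P (process A u₀) := by
  have hp := h.isProbabilityMeasure_slotLaw
  refine ⟨fun x y => slotLaw P A {v | step x v = y}, fun x => ?_, fun n s => ?_⟩
  · rw [← measure_iUnion]
    · have : ⋃ y, {v | step x v = y} = Set.univ := by ext; simp
      rw [this, measure_univ]
    · exact fun y y' hy => Set.disjoint_left.2 fun v hv hv' => hy (hv.symm.trans hv')
    · exact fun y => (Set.to_countable _).measurableSet
  · have hE : MeasurableSet[past A n] {ω | ∀ i ≤ n, process A u₀ i ω = s i} := by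
      simp only [Set.ofPred_forall]
      exact MeasurableSet.iInter fun i => MeasurableSet.iInter fun hi =>
        measurableSet_process A u₀ hi {s i}
    rw [← h.measure_inter_slot hE]
    congr 1
    ext ω
    simp only [Set.mem_inter_iff, Set.mem_ofPred_eq]
    constructor
    · intro hω
      refine ⟨fun i hi => hω i (by omega), ?_⟩
      rw [← hω n (by omega), ← hω (n + 1) le_rfl, process_succ]
    · rintro ⟨h1, h2⟩ i hi
      rcases Nat.le_succ_iff.1 hi with hi | rfl
      · exact h1 i hi
      · rw [← h2, process_succ, h1 n le_rfl]

lemma lintegral_process_succ (h : IsArrivalSystem lam P A) {t : ℕ} {E : Set Ω}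
    (hE : MeasurableSet[past A t] E) (g : State N → ℝ≥0∞) :
    ∫⁻ ω in E, g (process A u₀ (t + 1) ω) ∂P =
      ∫⁻ ω in E, mean P A g (process A u₀ t ω) ∂P := by
  have e : E = ⋃ x, E ∩ {ω | process A u₀ t ω = x} := by
    rw [← Set.inter_iUnion]; ext; simp
  have hm : ∀ x, MeasurableSet[past A t] (E ∩ {ω | process A u₀ t ω = x}) := fun x =>
    MeasurableSet.inter hE (measurableSet_process A u₀ le_rfl {x})
  have hd : Pairwise fun x y => Disjoint (E ∩ {ω | process A u₀ t ω = x})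
      (E ∩ {ω | process A u₀ t ω = y}) := fun x y hxy =>
    Set.disjoint_left.2 fun ω hx hy => hxy (hx.2.symm.trans hy.2)
  rw [e, lintegral_iUnion (fun x => h.past_le t _ (hm x)) hd,
    lintegral_iUnion (fun x => h.past_le t _ (hm x)) hd]
  refine tsum_congr fun x => ?_
  have h1 : ∫⁻ ω in E ∩ {ω | process A u₀ t ω = x}, g (process A u₀ (t + 1) ω) ∂P =
      ∫⁻ ω in E ∩ {ω | process A u₀ t ω = x}, g (step x (future A t ω 0)) ∂P :=
    setLIntegral_congr_fun (h.past_le t _ (hm x)) fun ω hω => by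
      rw [process_succ, hω.2]
  have h2 : ∫⁻ ω in E ∩ {ω | process A u₀ t ω = x}, mean P A g (process A u₀ t ω) ∂P =
      ∫⁻ _ in E ∩ {ω | process A u₀ t ω = x}, mean P A g x ∂P :=
    setLIntegral_congr_fun (h.past_le t _ (hm x)) fun ω hω => by
      rw [hω.2]
  rw [h1, h2, h.lintegral_inter_slot (hm x) fun v => g (step x v), setLIntegral_const, mul_comm]
  rfl

/-- Foster's criterion: a Lyapunov function bounds the mean time until the next visit to `z`,
conditionally on any event of the past on which the present state is `x`. -/
lemma lintegral_returnTime_le (h : IsArrivalSystem lam P A) {z : State N}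
    {U : State N → ℝ≥0∞} (hU : ∀ x, x ≠ z → mean P A U x + 1 ≤ U x) {t : ℕ} {E : Set Ω}
    (hE : MeasurableSet[past A t] E) {x : State N} (hx : ∀ ω ∈ E, process A u₀ t ω = x) :
    ∫⁻ ω in E, returnTime (process A u₀) z t ω ∂P ≤ P E * (1 + mean P A U x) := by
  set R : ℕ → Set Ω := fun k => {ω | ∀ i < k, process A u₀ (t + (i + 1)) ω ≠ z}
  have hR : ∀ k, MeasurableSet[past A (t + k)] (R k) := fun k => by
    simp only [R, Set.ofPred_forall]
    exact MeasurableSet.iInter fun i => MeasurableSet.iInter fun hi =>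
      measurableSet_process A u₀ (by omega) {z}ᶜ
  have hB : ∀ k, MeasurableSet[past A (t + k)] (R k ∩ E) := fun k =>
    MeasurableSet.inter (hR k) (past_mono A (Nat.le_add_right t k) _ hE)
  set m : ℕ → ℝ≥0∞ := fun k => ∫⁻ ω in R k ∩ E, U (process A u₀ (t + k + 1) ω) ∂P
  have hm0 : m 0 = P E * mean P A U x := by
    have e : R 0 ∩ E = E := by simp [R]
    simp only [m, e, add_zero]
    rw [h.lintegral_process_succ u₀ hE, mul_comm, ← setLIntegral_const]
    exact setLIntegral_congr_fun (h.past_le t _ hE) fun ω hω => by rw [hx ω hω]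
  have hm : ∀ k, m (k + 1) + P (R (k + 1) ∩ E) ≤ m k := by
    intro k
    have hsub : R (k + 1) ∩ E ⊆ R k ∩ E := fun ω hω => ⟨fun i hi => hω.1 i (by omega), hω.2⟩
    calc _ = ∫⁻ ω in R (k + 1) ∩ E, (mean P A U (process A u₀ (t + (k + 1)) ω) + 1) ∂P := by
          rw [lintegral_add_right _ measurable_const, setLIntegral_const, one_mul,
            ← h.lintegral_process_succ u₀ (hB (k + 1))]
      _ ≤ ∫⁻ ω in R (k + 1) ∩ E, U (process A u₀ (t + k + 1) ω) ∂P :=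
        setLIntegral_mono' (h.past_le _ _ (hB (k + 1))) fun ω hω =>
          hU _ (hω.1 k (Nat.lt_succ_self k))
      _ ≤ m k := lintegral_mono_set hsub
  have hsum : ∀ n, ∑ k ∈ Finset.range n, P (R (k + 1) ∩ E) + m n ≤ m 0 := by
    intro n
    induction n with
    | zero => simp
    | succ n ih =>
      refine le_trans ?_ ih
      rw [Finset.sum_range_succ, add_assoc, add_comm (P _)]
      gcongr
      exact hm n
  calc ∫⁻ ω in E, returnTime (process A u₀) z t ω ∂P
      ≤ ∫⁻ ω in E, ∑' k, (R k).indicator (fun _ => 1) ω ∂P :=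
        lintegral_mono fun ω => returnTime_le_tsum _ _ _ _
    _ = ∑' k, P (R k ∩ E) := by
      rw [lintegral_tsum fun k =>
        (measurable_const.indicator (h.past_le _ _ (hR k))).aemeasurable]
      refine tsum_congr fun k => ?_
      rw [lintegral_indicator (h.past_le _ _ (hR k)), setLIntegral_const, one_mul,
        Measure.restrict_apply (h.past_le _ _ (hR k))]
    _ = P (R 0 ∩ E) + ∑' k, P (R (k + 1) ∩ E) := tsum_eq_zero_add' ENNReal.summable
    _ ≤ P E + m 0 := by
      gcongr
      · exact Set.inter_subset_right
      · exact ENNReal.tsum_le_of_sum_range_le fun n => le_self_add.trans (hsum n)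
    _ = _ := by rw [hm0, mul_add, mul_one]

lemma exists_isLikely_of_isStateOf (h : IsArrivalSystem lam P A) {z : State N}
    (hz : IsStateOf P (process A u₀) z) (x : State N) :
    ∃ w, IsLikely P A w ∧ w.foldl step x = z := by
  have key : ∀ n z, P {ω | process A u₀ n ω = z} ≠ 0 →
      ∃ w, IsLikely P A w ∧ w.foldl step (0, u₀ - 1) = z := by
    intro n
    induction n with
    | zero =>
      intro z hz
      refine ⟨[z.1], ?_, ?_⟩
      · intro v hv
        rw [List.mem_singleton.1 hv, h.slotLaw_singleton 0]
        exact fun h0 => hz (measure_mono_null (fun ω hω => congrArg Prod.fst hω) h0)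
      · have hz2 : z.2 = u₀ := by
          obtain ⟨ω, hω⟩ := nonempty_of_measure_ne_zero hz
          exact (congrArg Prod.snd hω).symm
        have hc : cyclicExhaustive ((0, u₀ - 1) : State N) = u₀ := by
          rw [cyclicExhaustive_of_isPolled (by simp [IsPolled]), sub_add_cancel]
        refine Prod.ext (funext fun j => ?_) ?_
        · simp [step]
        · exact hc.trans hz2.symm
    | succ n ih =>
      intro z hz
      obtain ⟨⟨x, v⟩, hxv⟩ := exists_measure_inter_ne_zero hz (F := fun p : State N × (Fin N → ℕ) =>
        {ω | process A u₀ n ω = p.1 ∧ future A n ω 0 = p.2}) fun ω _ => ⟨(_, _), rfl, rfl⟩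
      obtain ⟨w, hw, hwx⟩ := ih x fun h0 =>
        hxv (measure_mono_null (fun ω hω => hω.2.1) h0)
      have hv : slotLaw P A {v} ≠ 0 := by
        rw [h.slotLaw_singleton (n + 1)]
        exact fun h0 => hxv (measure_mono_null (fun ω hω => hω.2.2) h0)
      refine ⟨w ++ [v], hw.append (by simpa [IsLikely] using hv), ?_⟩
      obtain ⟨ω, hω⟩ := nonempty_of_measure_ne_zero hxv
      rw [List.foldl_append, hwx, List.foldl_cons, List.foldl_nil, ← hω.1, process_succ,
        hω.2.1, hω.2.2]
  obtain ⟨n, hn⟩ := hz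
  obtain ⟨w, hw, hwz⟩ := key n z hn
  obtain ⟨k, hk⟩ := exists_foldl_zero_eq x (u₀ - 1)
  exact ⟨_, (h.isLikely_zero k).append hw, by rw [List.foldl_append, hk, hwz]⟩

/-- The mean return times are bounded, uniformly over the events of the past. -/
lemma exists_lintegral_returnTime_le (h : IsArrivalSystem lam P A) {z : State N}
    (hz : IsStateOf P (process A u₀) z) (x : State N) :
    ∃ M : ℝ≥0∞, M ≠ ∞ ∧ ∀ (t : ℕ) (E : Set Ω), MeasurableSet[past A t] E →
      (∀ ω ∈ E, process A u₀ t ω = x) →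
        ∫⁻ ω in E, returnTime (process A u₀) z t ω ∂P ≤ P E * M := by
  obtain ⟨U, hU, hUz⟩ := h.exists_lyapunov (h.exists_isLikely_of_isStateOf u₀ hz)
  exact ⟨1 + mean P A U x, ENNReal.add_ne_top.2 ⟨ENNReal.one_ne_top, hU x⟩,
    fun t E hE hx => h.lintegral_returnTime_le u₀ hUz hE hx⟩

lemma isPositiveRecurrentChain_process (h : IsArrivalSystem lam P A) :
    IsPositiveRecurrentChain P (process A u₀) where
  markov := h.isMarkovChain_process u₀
  irreducible x y m hx hy := by
    obtain ⟨w, hw, hwy⟩ := h.exists_isLikely_of_isStateOf u₀ hy x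
    refine ⟨w.length, fun h0 => h.measure_follows_ne_zero
      (measurableSet_process A u₀ (le_refl m) {x}) hx hw (measure_mono_null ?_ h0)⟩
    rintro ω ⟨h1, h2⟩
    refine ⟨h1, ?_⟩
    rw [h2.process_eq, show process A u₀ m ω = x from h1, hwy]
  positiveRecurrent x hx n := by
    obtain ⟨M, hM, hle⟩ := h.exists_lintegral_returnTime_le u₀ hx x
    exact (hle n _ (measurableSet_process A u₀ (le_refl n) {x}) fun _ hω => hω).trans_lt
      (ENNReal.mul_lt_top (measure_lt_top _ _) hM.lt_top)

/-- Almost surely, every state of the chain is visited after every time. -/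
lemma ae_forall_exists_process_eq (h : IsArrivalSystem lam P A) {z : State N}
    (hz : IsStateOf P (process A u₀) z) :
    ∀ᵐ ω ∂P, ∀ t, ∃ k, 0 < k ∧ process A u₀ (t + k) ω = z := by
  rw [ae_all_iff]
  intro t
  by_contra hne
  obtain ⟨x, hx⟩ := exists_measure_inter_ne_zero (P := P)
    (E := {ω | ¬ ∃ k, 0 < k ∧ process A u₀ (t + k) ω = z}) hne
    (F := fun x => {ω | process A u₀ t ω = x}) fun ω _ => ⟨_, rfl⟩
  obtain ⟨M, hM, hle⟩ := h.exists_lintegral_returnTime_le u₀ hz x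
  have h1 := hle t _ (measurableSet_process A u₀ (le_refl t) {x}) fun _ hω => hω
  have h2 : ∞ * P ({ω | ¬ ∃ k, 0 < k ∧ process A u₀ (t + k) ω = z} ∩
      {ω | process A u₀ t ω = x}) ≤
      ∫⁻ ω in {ω | process A u₀ t ω = x}, returnTime (process A u₀) z t ω ∂P := by
    rw [← setLIntegral_const]
    refine (setLIntegral_mono' ?_ ?_).trans (lintegral_mono_set Set.inter_subset_right)
    · refine MeasurableSet.inter ?_ (h.measurableSet_process_eq u₀ t x)
      have hk : MeasurableSet {ω | ∃ k, 0 < k ∧ process A u₀ (t + k) ω = z} := by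
        simp only [Set.ofPred_exists]
        exact MeasurableSet.iUnion fun k => (MeasurableSet.const _).inter
          (h.measurableSet_process_eq u₀ (t + k) z)
      exact hk.compl
    · rintro ω ⟨hω, -⟩
      exact le_iInf₂ fun k hk => (hω ⟨k, hk⟩).elim
  rw [ENNReal.top_mul hx] at h2
  exact (ENNReal.mul_lt_top (measure_lt_top P _) hM.lt_top).not_ge (h2.trans h1)

end IsArrivalSystem

end StateChain

/-! ### The process at the polling instants -/

section PolledChain

open Classical

variable {N : ℕ} [NeZero N]

/-- The state of the chain at a polling instant at which the polled process is at `x`: the server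
is still at the queue before the one at which it arrives. -/
def before (x : State N) : State N := (x.1, x.2 - 1)

/-- What the polled process records at a polling instant with state `x`. -/
def after (x : State N) : State N := (x.1, x.2 + 1)

lemma after_before (x : State N) : after (before x) = x := by
  simp [after, before]

lemma before_after (x : State N) : before (after x) = x := by
  simp [after, before]

/-- The position of the server determines the number of polling instants modulo `N`. -/
lemma foldl_step_snd (x : State N) (w : List (Fin N → ℕ)) :
    (w.foldl step x).2 = x.2 + pollCount x w • (1 : Fin N) := by
  induction w generalizing x with
  | nil => simp [pollCount]
  | cons v w ih =>
    rw [List.foldl_cons, ih, pollCount]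
    change cyclicExhaustive x + _ = _
    split_ifs with hp
    · rw [cyclicExhaustive_of_isPolled hp, add_nsmul, one_nsmul, add_assoc]
    · rw [cyclicExhaustive_of_pos (Nat.pos_of_ne_zero hp), zero_add]

lemma dvd_pollCount {x : State N} {w : List (Fin N → ℕ)} (h : (w.foldl step x).2 = x.2) :
    N ∣ pollCount x w := by
  rw [foldl_step_snd, add_eq_left, ← zero_nsmul (1 : Fin N), nsmul_one_eq_nsmul_one] at h
  exact (Nat.modEq_zero_iff_dvd).1 h

/-- After `r` slots, the run from `x` under the arrivals `a` is at the polling instant that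
completes a cycle. -/
def EndsCycle (x : State N) (a : ℕ → Fin N → ℕ) (r : ℕ) : Prop :=
  IsPolled (run x a r) ∧ Nat.count (fun s => IsPolled (run x a s)) r = N

/-- The polled process one cycle after the state `x`, under the arrivals `a` (and `x` itself if
the cycle never ends). -/
noncomputable def nextPolled (x : State N) (a : ℕ → Fin N → ℕ) : State N :=
  if h : ∃ r, EndsCycle (before x) a r then after (run (before x) a h.choose) else x

lemma nextPolled_eq {x : State N} {a : ℕ → Fin N → ℕ} {r : ℕ} (h : EndsCycle (before x) a r) :
    nextPolled x a = after (run (before x) a r) := by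
  have hex : ∃ r, EndsCycle (before x) a r := ⟨r, h⟩
  rw [nextPolled, dif_pos hex]
  have := Nat.count_injective (p := fun s => IsPolled (run (before x) a s))
    hex.choose_spec.1 h.1 (hex.choose_spec.2.trans h.2.symm)
  rw [this]

lemma measurableSet_endsCycle (x : State N) (r : ℕ) : MeasurableSet {a | EndsCycle x a r} := by
  have hp : ∀ s, MeasurableSet {a | IsPolled (run x a s)} := fun s =>
    measurable_run x s (Set.to_countable {y | IsPolled y}).measurableSet
  have hc : ∀ s, Measurable fun a => Nat.count (fun s => IsPolled (run x a s)) s := by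
    intro s
    induction s with
    | zero => simp
    | succ s ih =>
      simp only [Nat.count_succ]
      exact ih.add (Measurable.ite (hp s) measurable_const measurable_const)
  exact (hp r).inter (hc r (measurableSet_singleton N))

lemma measurable_nextPolled (x : State N) : Measurable (nextPolled x) := by
  refine measurable_to_countable' fun y => ?_
  have e : nextPolled x ⁻¹' {y} =
      (⋃ r, {a | EndsCycle (before x) a r} ∩ {a | after (run (before x) a r) = y}) ∪
        ((⋃ r, {a | EndsCycle (before x) a r})ᶜ ∩ {_a | x = y}) := by
    ext a
    simp only [Set.mem_preimage, Set.mem_singleton_iff, Set.mem_union, Set.mem_iUnion,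
      Set.mem_inter_iff, Set.mem_ofPred_eq, Set.mem_compl_iff]
    by_cases h : ∃ r, EndsCycle (before x) a r
    · obtain ⟨r, hr⟩ := h
      rw [nextPolled_eq hr]
      constructor
      · exact fun hy => Or.inl ⟨r, hr, hy⟩
      · rintro (⟨s, hs, hy⟩ | ⟨hn, -⟩)
        · rwa [← nextPolled_eq hr, nextPolled_eq hs]
        · exact (hn ⟨r, hr⟩).elim
    · rw [nextPolled, dif_neg h]
      constructor
      · exact fun hy => Or.inr ⟨h, hy⟩
      · rintro (⟨s, hs, -⟩ | ⟨-, hy⟩)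
        · exact (h ⟨s, hs⟩).elim
        · exact hy
  rw [e]
  refine (MeasurableSet.iUnion fun r => (measurableSet_endsCycle _ r).inter ?_).union
    ((MeasurableSet.iUnion fun r => measurableSet_endsCycle _ r).compl.inter (.const _))
  exact measurable_run (before x) r (Set.to_countable {y' | after y' = y}).measurableSet

section Events

variable {Ω : Type*} (A : ℕ → Fin N → Ω → ℕ) (u₀ : Fin N)

/-- The event that slot `t` is the `n`-th polling instant and the polled process is then at
`x`. -/
def pollEvent (n t : ℕ) (x : State N) : Set Ω :=
  {ω | process A u₀ t ω = before x ∧ IsPolled (before x) ∧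
    Nat.count (IsPollingInstant A u₀ ω) t = n}

lemma measurable_count (t : ℕ) :
    Measurable[past A t] fun ω => Nat.count (IsPollingInstant A u₀ ω) t := by
  induction t with
  | zero => simp
  | succ t ih =>
    simp only [count_isPolled_succ]
    refine (ih.mono (past_mono A (Nat.le_succ t)) le_rfl).add ?_
    exact Measurable.ite (measurableSet_process A u₀ (Nat.le_succ t) {x | IsPolled x})
      (@measurable_const _ _ _ (_) _) (@measurable_const _ _ _ (_) _)

lemma measurableSet_pollEvent {n t r : ℕ} (h : t ≤ r) (x : State N) :
    MeasurableSet[past A r] (pollEvent A u₀ n t x) := by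
  refine past_mono A h _ ?_
  exact MeasurableSet.inter (measurableSet_process A u₀ (le_refl t) {before x})
    (MeasurableSet.inter (MeasurableSet.const _)
      (measurable_count A u₀ t (measurableSet_singleton n)))

variable {A u₀} {n t : ℕ} {x : State N} {ω : Ω}

lemma isPollingInstant_of_mem (h : ω ∈ pollEvent A u₀ n t x) : IsPollingInstant A u₀ ω t := by
  have h2 := h.2.1
  rwa [← h.1] at h2

lemma eq_of_mem_pollEvent {s : ℕ} {y : State N} (h : ω ∈ pollEvent A u₀ n t x)
    (h' : ω ∈ pollEvent A u₀ n s y) : t = s :=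
  Nat.count_injective (isPollingInstant_of_mem h) (isPollingInstant_of_mem h')
    (h.2.2.trans h'.2.2.symm)

lemma disjoint_pollEvent {s : ℕ} {y : State N} (h : t ≠ s) :
    Disjoint (pollEvent A u₀ n t x) (pollEvent A u₀ n s y) :=
  Set.disjoint_left.2 fun _ h1 h2 => h (eq_of_mem_pollEvent h1 h2)

lemma polledProcess_of_mem (h : ω ∈ pollEvent A u₀ n t x) : polledProcess A u₀ n ω = x := by
  have h1 : Nat.nth (IsPollingInstant A u₀ ω) n = t := by
    rw [← h.2.2, Nat.nth_count (isPollingInstant_of_mem h)]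
  simp only [polledProcess, h1, h.1, cyclicExhaustive_of_isPolled h.2.1]
  exact after_before x

lemma mem_pollEvent_nth (h : {t | IsPollingInstant A u₀ ω t}.Infinite) (n : ℕ) :
    ω ∈ pollEvent A u₀ n (Nat.nth (IsPollingInstant A u₀ ω) n) (polledProcess A u₀ n ω) := by
  have hp : IsPolled (process A u₀ (Nat.nth (IsPollingInstant A u₀ ω) n) ω) :=
    Nat.nth_mem_of_infinite h n
  have e : before (polledProcess A u₀ n ω) =
      process A u₀ (Nat.nth (IsPollingInstant A u₀ ω) n) ω := by
    simp only [polledProcess, cyclicExhaustive_of_isPolled hp]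
    exact before_after _
  refine ⟨e.symm, ?_, Nat.count_nth_of_infinite h n⟩
  rwa [e]

lemma snd_of_mem_pollEvent (h : ω ∈ pollEvent A u₀ n t x) : (before x).2 = u₀ + n • 1 := by
  rw [← h.1, process_snd_eq, h.2.2]

lemma nextPolled_future {y : State N} {s : ℕ} (h : ω ∈ pollEvent A u₀ n t x)
    (h' : ω ∈ pollEvent A u₀ (n + N) s y) : nextPolled x (future A t ω) = y := by
  have hlt : t ≤ s := by
    by_contra! hlt
    have := Nat.count_monotone (IsPollingInstant A u₀ ω) hlt.le
    rw [h.2.2, h'.2.2] at this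
    have := NeZero.pos N
    omega
  obtain ⟨r, rfl⟩ := Nat.exists_eq_add_of_le hlt
  have hrun : ∀ r, run (before x) (future A t ω) r = process A u₀ (t + r) ω := fun r => by
    rw [process_add, h.1]
  have hc := Nat.count_add (IsPollingInstant A u₀ ω) t r
  rw [h.2.2, h'.2.2] at hc
  have he : EndsCycle (before x) (future A t ω) r := by
    simp only [EndsCycle, hrun]
    exact ⟨isPollingInstant_of_mem h', (Nat.add_left_cancel hc).symm⟩
  rw [nextPolled_eq he, hrun, h'.1, after_before]

/-- The polled process returns to a state no later, in cycles, than the state process does, in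
slots. -/
lemma returnTime_polledProcess_le {k m : ℕ} (h : ω ∈ pollEvent A u₀ (m * N + k) t x) :
    returnTime (fun n => polledProcess A u₀ (n * N + k)) x m ω ≤
      returnTime (process A u₀) (before x) t ω := by
  refine le_iInf₂ fun s hs => ?_
  set c := Nat.count (fun r => IsPollingInstant A u₀ ω (t + r)) s
  have hadd : Nat.count (IsPollingInstant A u₀ ω) (t + s) = m * N + k + c := by
    rw [Nat.count_add, h.2.2]
  have hcs : c ≤ s := Nat.count_le _
  have hc0 : 0 < c := by
    have h1 : Nat.count (fun r => IsPollingInstant A u₀ ω (t + r)) 1 ≤ c :=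
      Nat.count_monotone _ hs.1
    rw [Nat.count_succ, Nat.count_zero, add_zero, if_pos (isPollingInstant_of_mem h)] at h1
    omega
  have hdvd : N ∣ c := by
    have h1 := process_snd_eq (A := A) (u₀ := u₀) ω (t + s)
    rw [hs.2, snd_of_mem_pollEvent h, hadd, add_right_inj, nsmul_one_eq_nsmul_one] at h1
    exact (Nat.modEq_zero_iff_dvd).1 (Nat.ModEq.add_left_cancel' _ h1.symm)
  obtain ⟨j, hj⟩ := hdvd
  have hj0 : 0 < j := Nat.pos_of_ne_zero fun e => by simp [hj, e] at hc0
  have hjs : j ≤ s := (Nat.le_mul_of_pos_left j (NeZero.pos N)).trans (hj ▸ hcs)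
  have hmem : ω ∈ pollEvent A u₀ ((m + j) * N + k) (t + s) x :=
    ⟨hs.2, h.2.1, by rw [hadd, hj]; ring⟩
  exact (iInf₂_le j ⟨hj0, polledProcess_of_mem hmem⟩).trans (by exact_mod_cast hjs)

end Events

namespace IsArrivalSystem

variable {Ω : Type*} [MeasurableSpace Ω] {lam : Fin N → ℝ} {P : Measure Ω}
  [IsProbabilityMeasure P] {A : ℕ → Fin N → Ω → ℕ} (u₀ : Fin N)

lemma ae_infinite_isPollingInstant (h : IsArrivalSystem lam P A) :
    ∀ᵐ ω ∂P, {t | IsPollingInstant A u₀ ω t}.Infinite := by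
  have hz : IsStateOf P (process A u₀) (0, u₀) := by
    refine ⟨0, ?_⟩
    have h0 := h.slotLaw_zero_ne_zero
    rw [h.slotLaw_singleton 0] at h0
    exact fun h1 => h0 (measure_mono_null (fun ω hω => congrArg (fun q => (q, u₀)) hω) h1)
  filter_upwards [h.ae_forall_exists_process_eq u₀ hz] with ω hω
  refine Set.infinite_of_forall_exists_gt fun t => ?_
  obtain ⟨k, hk, hp⟩ := hω t
  exact ⟨t + k, by simp [IsPollingInstant, hp], by omega⟩

lemma exists_pollEvent_ne_zero (h : IsArrivalSystem lam P A) {n : ℕ} {x : State N}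
    (hx : P {ω | polledProcess A u₀ n ω = x} ≠ 0) : ∃ t, P (pollEvent A u₀ n t x) ≠ 0 := by
  by_contra! h0
  refine hx (measure_mono_null_ae ?_ (measure_iUnion_null h0))
  filter_upwards [h.ae_infinite_isPollingInstant u₀] with ω hω hωx
  have h1 := mem_pollEvent_nth hω n
  rw [show polledProcess A u₀ n ω = x from hωx] at h1
  exact Set.mem_iUnion.2 ⟨_, h1⟩

lemma isPolled_before (h : IsArrivalSystem lam P A) {n : ℕ} {x : State N}
    (hx : P {ω | polledProcess A u₀ n ω = x} ≠ 0) : IsPolled (before x) := by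
  obtain ⟨t, ht⟩ := h.exists_pollEvent_ne_zero u₀ hx
  obtain ⟨ω, hω⟩ := nonempty_of_measure_ne_zero ht
  exact hω.2.1

lemma before_snd (h : IsArrivalSystem lam P A) {m k : ℕ} {x : State N}
    (hx : P {ω | polledProcess A u₀ (m * N + k) ω = x} ≠ 0) : (before x).2 = u₀ + k • 1 := by
  obtain ⟨t, ht⟩ := h.exists_pollEvent_ne_zero u₀ hx
  obtain ⟨ω, hω⟩ := nonempty_of_measure_ne_zero ht
  rw [snd_of_mem_pollEvent hω, add_right_inj, nsmul_one_eq_nsmul_one]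
  simp [Nat.ModEq]

lemma isStateOf_before (h : IsArrivalSystem lam P A) {n : ℕ} {x : State N}
    (hx : P {ω | polledProcess A u₀ n ω = x} ≠ 0) : IsStateOf P (process A u₀) (before x) := by
  obtain ⟨t, ht⟩ := h.exists_pollEvent_ne_zero u₀ hx
  exact ⟨t, fun h0 => ht (measure_mono_null (fun ω hω => hω.1) h0)⟩

/-- A likely arrival sequence that leads from `x` to `y` in `j` full cycles makes the transition
from `x` to `y` in `j` steps of the polled process possible. -/
lemma measure_polled_ne_zero (h : IsArrivalSystem lam P A) {k m j : ℕ} {x y : State N}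
    (hx : P {ω | polledProcess A u₀ (m * N + k) ω = x} ≠ 0) {w : List (Fin N → ℕ)}
    (hw : IsLikely P A w) (hwy : w.foldl step (before x) = before y) (hy : IsPolled (before y))
    (hj : pollCount (before x) w = j * N) :
    P {ω | polledProcess A u₀ (m * N + k) ω = x ∧
      polledProcess A u₀ ((m + j) * N + k) ω = y} ≠ 0 := by
  obtain ⟨t, ht⟩ := h.exists_pollEvent_ne_zero u₀ hx
  refine fun h0 => h.measure_follows_ne_zero (measurableSet_pollEvent A u₀ (le_refl t) x) ht hw
    (measure_mono_null ?_ h0)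
  rintro ω ⟨h1, h2⟩
  refine ⟨polledProcess_of_mem h1, polledProcess_of_mem (t := t + w.length) ⟨?_, hy, ?_⟩⟩
  · rw [h2.process_eq, h1.1, hwy]
  · rw [h2.count_eq, h1.2.2, h1.1, hj]
    ring

lemma isMarkovChain_polled (h : IsArrivalSystem lam P A) (k : ℕ) :
    IsMarkovChain P fun n => polledProcess A u₀ (n * N + k) := by
  have hprob := h.isProbabilityMeasure_pathLaw
  refine ⟨fun x y => pathLaw P A (nextPolled x ⁻¹' {y}), fun x => ?_, fun n s => ?_⟩
  · rw [← measure_iUnion]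
    · have : ⋃ y, nextPolled x ⁻¹' {y} = Set.univ := by ext; simp
      rw [this, measure_univ]
    · exact fun y y' hy => Set.disjoint_left.2 fun v hv hv' => hy (hv.symm.trans hv')
    · exact fun y => measurable_nextPolled x (measurableSet_singleton y)
  -- `D t`: the polled process has followed `s` up to its `n`-th instant, which is slot `t`
  set D : ℕ → Set Ω := fun t => pollEvent A u₀ (n * N + k) t (s n) ∩
    ⋂ i ≤ n, ⋃ r ≤ t, pollEvent A u₀ (i * N + k) r (s i)
  have hD : ∀ t, MeasurableSet[past A t] (D t) := fun t =>
    MeasurableSet.inter (measurableSet_pollEvent A u₀ le_rfl _)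
      (MeasurableSet.iInter fun i => MeasurableSet.iInter fun _ => MeasurableSet.iUnion fun r =>
        MeasurableSet.iUnion fun hr => measurableSet_pollEvent A u₀ hr _)
  have hdis : Pairwise fun t t' => Disjoint (D t) (D t') := fun t t' htt =>
    (disjoint_pollEvent htt).mono Set.inter_subset_left Set.inter_subset_left
  have hB := measurable_nextPolled (s n) (measurableSet_singleton (s (n + 1)))
  have hDs : ∀ ω t, ω ∈ D t → ∀ i ≤ n, polledProcess A u₀ (i * N + k) ω = s i := by
    intro ω t hω i hi
    have := Set.mem_iInter₂.1 hω.2 i hi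
    simp only [Set.mem_iUnion] at this
    obtain ⟨r, _, hr⟩ := this
    exact polledProcess_of_mem hr
  have hsD : ∀ ω, {t | IsPollingInstant A u₀ ω t}.Infinite →
      (∀ i ≤ n, polledProcess A u₀ (i * N + k) ω = s i) →
        ω ∈ D (Nat.nth (IsPollingInstant A u₀ ω) (n * N + k)) := by
    intro ω hinf hω
    refine ⟨hω n le_rfl ▸ mem_pollEvent_nth hinf _, Set.mem_iInter₂.2 fun i hi => ?_⟩
    simp only [Set.mem_iUnion]
    refine ⟨_, (Nat.nth_monotone hinf) ?_, hω i hi ▸ mem_pollEvent_nth hinf _⟩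
    gcongr
  have e1 : {ω | ∀ i ≤ n, polledProcess A u₀ (i * N + k) ω = s i} =ᵐ[P] ⋃ t, D t := by
    rw [Filter.eventuallyEq_set]
    filter_upwards [h.ae_infinite_isPollingInstant u₀] with ω hinf
    rw [Set.mem_iUnion]
    exact ⟨fun hω => ⟨_, hsD ω hinf hω⟩, fun ⟨t, ht⟩ => hDs ω t ht⟩
  have e2 : {ω | ∀ i ≤ n + 1, polledProcess A u₀ (i * N + k) ω = s i} =ᵐ[P]
      ⋃ t, D t ∩ future A t ⁻¹' (nextPolled (s n) ⁻¹' {s (n + 1)}) := by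
    rw [Filter.eventuallyEq_set]
    filter_upwards [h.ae_infinite_isPollingInstant u₀] with ω hinf
    have hnext : ∀ t, ω ∈ D t →
        nextPolled (s n) (future A t ω) = polledProcess A u₀ ((n + 1) * N + k) ω := by
      intro t ht
      refine nextPolled_future ht.1 (s := Nat.nth (IsPollingInstant A u₀ ω) ((n + 1) * N + k)) ?_
      rw [show n * N + k + N = (n + 1) * N + k by ring]
      exact mem_pollEvent_nth hinf _
    simp only [Set.mem_iUnion, Set.mem_inter_iff, Set.mem_preimage, Set.mem_singleton_iff]
    constructor
    · intro hω
      have hm := hsD ω hinf fun i hi => hω i (by omega)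
      exact ⟨_, hm, (hnext _ hm).trans (hω (n + 1) le_rfl)⟩
    · rintro ⟨t, ht, hn⟩ i hi
      rcases Nat.le_succ_iff.1 hi with hi | rfl
      · exact hDs ω t ht i hi
      · rw [← hnext t ht, hn]
  rw [measure_congr e1, measure_congr e2, measure_iUnion hdis fun t => h.past_le t _ (hD t),
    measure_iUnion]
  · rw [← ENNReal.tsum_mul_right]
    exact tsum_congr fun t => h.measure_inter_future (hD t) hB
  · exact fun t t' htt => (hdis htt).mono Set.inter_subset_left Set.inter_subset_left
  · exact fun t => (h.past_le t _ (hD t)).inter (h.measurable_future t hB)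

lemma isErgodicChain_polled (h : IsArrivalSystem lam P A) (k : ℕ) :
    IsErgodicChain P fun n => polledProcess A u₀ (n * N + k) where
  markov := h.isMarkovChain_polled u₀ k
  irreducible x y m hx hy := by
    obtain ⟨n, hy⟩ := hy
    obtain ⟨w, hw, hwy⟩ :=
      h.exists_isLikely_of_isStateOf u₀ (h.isStateOf_before u₀ hy) (before x)
    obtain ⟨j, hj⟩ : N ∣ pollCount (before x) w :=
      dvd_pollCount (by rw [hwy, h.before_snd u₀ hy, h.before_snd u₀ hx])
    exact ⟨j, h.measure_polled_ne_zero u₀ hx hw hwy (h.isPolled_before u₀ hy)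
      (hj.trans (mul_comm _ _))⟩
  positiveRecurrent x hx m := by
    obtain ⟨n, hx⟩ := hx
    obtain ⟨M, hM, hle⟩ :=
      h.exists_lintegral_returnTime_le u₀ (h.isStateOf_before u₀ hx) (before x)
    have hms : ∀ t, MeasurableSet (pollEvent A u₀ (m * N + k) t x) := fun t =>
      h.past_le t _ (measurableSet_pollEvent A u₀ le_rfl x)
    have hdis : Pairwise fun t s => Disjoint (pollEvent A u₀ (m * N + k) t x)
        (pollEvent A u₀ (m * N + k) s x) := fun t s hts => disjoint_pollEvent hts
    have hae : {ω | polledProcess A u₀ (m * N + k) ω = x} ≤ᵐ[P]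
        ⋃ t, pollEvent A u₀ (m * N + k) t x := by
      filter_upwards [h.ae_infinite_isPollingInstant u₀] with ω hω hωx
      have h1 := mem_pollEvent_nth hω (m * N + k)
      rw [show polledProcess A u₀ (m * N + k) ω = x from hωx] at h1
      exact Set.mem_iUnion.2 ⟨_, h1⟩
    refine (lintegral_mono_set' hae).trans_lt ?_
    rw [lintegral_iUnion hms hdis]
    calc _ ≤ ∑' t, P (pollEvent A u₀ (m * N + k) t x) * M := by
          refine ENNReal.tsum_le_tsum fun t => ?_
          refine (setLIntegral_mono' (hms t) fun ω hω => returnTime_polledProcess_le hω).trans ?_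
          exact hle t _ (measurableSet_pollEvent A u₀ le_rfl x) fun ω hω => hω.1
      _ = P (⋃ t, pollEvent A u₀ (m * N + k) t x) * M := by
        rw [ENNReal.tsum_mul_right, measure_iUnion hdis hms]
      _ < ∞ := ENNReal.mul_lt_top (measure_lt_top _ _) hM.lt_top
  aperiodic x m hx d hd := by
    -- a loop at `x` through the empty system can be prolonged by any number of empty cycles
    have hxp := h.isPolled_before u₀ hx
    obtain ⟨n, hn⟩ := exists_foldl_zero_eq (before x) (before x).2
    obtain ⟨w, hw, hwx⟩ := h.exists_isLikely_of_isStateOf u₀ (h.isStateOf_before u₀ hx)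
      (0, (before x).2)
    set w' : ℕ → List (Fin N → ℕ) := fun r =>
      List.replicate n 0 ++ (List.replicate (r * N) 0 ++ w)
    have hzero : ∀ r, (List.replicate (r * N) (0 : Fin N → ℕ)).foldl step
        ((0, (before x).2) : State N) = (0, (before x).2) := fun r => by
      have : (r * N) • (1 : Fin N) = 0 := by
        rw [← zero_nsmul (1 : Fin N), nsmul_one_eq_nsmul_one]
        simp [Nat.ModEq]
      rw [foldl_zero_zero, this, add_zero]
    have hfold : ∀ r, (w' r).foldl step (before x) = before x := fun r => by
      rw [List.foldl_append, hn, List.foldl_append, hzero, hwx]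
    have hlik : ∀ r, IsLikely P A (w' r) := fun r =>
      (h.isLikely_zero n).append ((h.isLikely_zero _).append hw)
    have hcount : ∀ r, pollCount (before x) (w' r) = pollCount (before x) (w' 0) + r * N :=
      fun r => by
        simp only [w', pollCount_append, hn, hzero, pollCount_zero_zero]
        ring
    obtain ⟨q, hq⟩ := dvd_pollCount (congrArg Prod.snd (hfold 0))
    have hdvd : ∀ r, 0 < r → d ∣ q + r := fun r hr =>
      hd (q + r) (by omega) (h.measure_polled_ne_zero u₀ hx (hlik r) (hfold r) hxp
        (by rw [hcount, hq]; ring))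
    have h1 := (Nat.dvd_sub (hdvd 2 (by norm_num)) (hdvd 1 (by norm_num)))
    rw [show q + 2 - (q + 1) = 1 by omega] at h1
    exact Nat.dvd_one.1 h1

end IsArrivalSystem

end PolledChain

end Polling

theorem mainTheorem3 {N : ℕ} [NeZero N] (lam : Fin N → ℝ) (hlam : lam ∈ Polling.capacityRegion N)
    {Ω : Type*} [MeasurableSpace Ω] (P : Measure Ω) [IsProbabilityMeasure P]
    (A : ℕ → Fin N → Ω → ℕ) (hmeas : ∀ t j, Measurable (A t j))
    (hindep : iIndepFun (fun (i : ℕ × Fin N) => A i.1 i.2) P)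
    (hone : ∀ t j, P {ω | A t j ω = 1} = ENNReal.ofReal (lam j))
    (hzero : ∀ t j, P {ω | A t j ω = 0} = ENNReal.ofReal (1 - lam j))
    (u₀ : Fin N) :
    Polling.IsPositiveRecurrentChain P (Polling.process A u₀) ∧
    (∀ᵐ ω ∂P, {t | Polling.IsPollingInstant A u₀ ω t}.Infinite) ∧
    ∀ k < N, Polling.IsErgodicChain P (fun n => Polling.polledProcess A u₀ (n * N + k)) := by
  have h : Polling.IsArrivalSystem lam P A := ⟨hlam, hmeas, hindep, hone, hzero⟩
  exact ⟨h.isPositiveRecurrentChain_process u₀, h.ae_infinite_isPollingInstant u₀,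
    fun k _ => h.isErgodicChain_polled u₀ k⟩
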